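/- Let $L^n$ be a totally ordered abelian group (written additively here) that is isomorphic to $\mathbb Z^n$ and has rank $n$ as an ordered group. That is, its isolated subgroups (the subgroups $H$ such that $g_1>g_2>0$ and $g_1\in H$ imply $g_2\in H$) form a tower $L^n=\hat L^n\supsetneq\hat L^{n-1}\supsetneq\dots\supsetneq\hat L^0=\{0\}$. Let $\hat{\mathcal C}$ be the set of all cones (semigroups with $0$) $\hat C\subset L^n$ generated by a $\mathbb Z$-basis of $L^n$ such that, for every $k=1,\dots,n$, exactly $k$ of the basis elements are positive elements of $\hat L^k$. Let $F(L)^*$ be the set of all nonzero formal series $f=\sum_{p\in L^n}f_p\,p$ with $f_p\in\mathbb C$ such that (1) $f$ converges at some point of the torus $T^n=\mathrm{Hom}(L^n,\mathbb C^*)$, i.e. for some $t\in T^n$ the family $(f_p\,t(p))_{p\in L^n}$ is absolutely summable; (2) the support $\{p: f_p\ne0\}$ is contained in $\hat C+p_0$ for some $\hat C\in\hat{\mathcal C}$ and $p_0\in L^n$. Let $F(L)=F(L)^*\sqcup\{0\}$. Then $F(L)$ is a field under coefficientwise addition and the product $(fg)_p=\sum_{q\in L^n}f_q\,g_{p-q}$,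 in which every sum has only finitely many nonzero terms. Moreover, the support of every $f\in F(L)^*$ has a least element $\nu(f)$ and is contained in $\hat C+\nu(f)$ for some $\hat C\in\hat{\mathcal C}$, and $\nu:F(L)^*\to L^n$ is a homomorphism from the multiplicative group of $F(L)$ to the ordered abelian group $L^n$ (i.e. a valuation on $F(L)$, in the sense of a homomorphism from the multiplicative group of a field to an ordered abelian group). -/

import Mathlib

namespace OrderedLattice

variable {G : Type*} [AddCommGroup G] [LinearOrder G]

/-- A subgroup `H` of an ordered abelian group is isolated if `g₁ > g₂ > 0` and `g₁ ∈ H`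
imply `g₂ ∈ H`. -/
def IsIsolated (H : AddSubgroup G) : Prop :=
  ∀ g₁ g₂ : G, 0 < g₂ → g₂ < g₁ → g₁ ∈ H → g₂ ∈ H

/-- `Lhat 0 < Lhat 1 < ... < Lhat n` is the tower of all isolated subgroups of `G`.
The existence of such a tower says that `G` has rank `n` as an ordered group. -/
def IsIsolatedTower {n : ℕ} (Lhat : Fin (n + 1) → AddSubgroup G) : Prop :=
  StrictMono Lhat ∧ ∀ H : AddSubgroup G, IsIsolated H ↔ ∃ k, Lhat k = H

/-- The set of simple cones adapted to the tower: semigroups (with `0`) generated by a `ℤ`-basis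
of the lattice, such that for every `k` exactly `k` of the generators are positive elements
of the `k`-th isolated subgroup. -/
def simpleCones {n : ℕ} (Lhat : Fin (n + 1) → AddSubgroup G) : Set (AddSubmonoid G) :=
  {C | ∃ x : Module.Basis (Fin n) ℤ G,
    C = AddSubmonoid.closure (Set.range x) ∧
    ∀ k : Fin (n + 1), {i : Fin n | x i ∈ Lhat k ∧ 0 < x i}.ncard = (k : ℕ)}

/-- The complex points of the torus whose character lattice is `G`. -/
abbrev Torus (G : Type*) [AddCommGroup G] : Type _ := Multiplicative G →* ℂˣ

/-- The formal series `∑ f_p p` converges at the point `t` of the torus: the family of complex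
numbers `f_p t(p)`, indexed by the lattice, is (absolutely) summable. -/
def ConvergesAt (f : G → ℂ) (t : Torus G) : Prop :=
  Summable fun p : G => f p * (t (Multiplicative.ofAdd p) : ℂ)

/-- The support of `f` lies in the shifted cone `C + p₀`. -/
def SupportedIn (f : G → ℂ) (C : AddSubmonoid G) (p₀ : G) : Prop :=
  ∀ p : G, f p ≠ 0 → p - p₀ ∈ C

/-- The nonzero Laurent series: nonzero formal complex linear combinations of elements of the
lattice that converge at some point of the torus and have support in a shifted adapted cone. -/
def laurentStar {n : ℕ} (Lhat : Fin (n + 1) → AddSubgroup G) : Set (G → ℂ) :=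
  {f | f ≠ 0 ∧ (∃ t : Torus G, ConvergesAt f t) ∧
    ∃ C ∈ simpleCones Lhat, ∃ p₀ : G, SupportedIn f C p₀}

/-- The set of Laurent series: the nonzero ones together with the zero series. -/
def laurentField {n : ℕ} (Lhat : Fin (n + 1) → AddSubgroup G) : Set (G → ℂ) :=
  laurentStar Lhat ∪ {0}

end OrderedLattice

/-! The generators of a simple cone are positive, so a simple cone is partially well-ordered and
every Laurent series is a Hahn series over the ordered group. Hahn series form a field whose order
is a valuation; what remains is that the Laurent series are a subfield and that their supports lie
in simple cones with vertex at the order.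

The key fact is `IsIsolatedTower.exists_simpleCone`: finitely many nonnegative elements always fit
into one simple cone. It puts two series into a common cone (`IsLaurent.exists_common`), and with
Dickson's lemma it moves the vertex to any lower bound of the support
(`IsLaurent.exists_supportedIn_of_le`).

Convergence is controlled by an `ℝ≥0∞`-valued weighted ℓ¹ norm, subadditive and submultiplicative.
Characters take arbitrary nonzero values on a basis, so a point of the torus can be chosen where the
generators of a cone are as small as needed. A series without constant term, supported in a cone
with vertex 0, then has norm at most 1/2, its geometric series converges (`isLaurent_hsum_powers`),
and inverses follow. -/

namespace OrderedLattice

open scoped ENNReal NNReal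
open HahnSeries

/-! ### Dickson's lemma and the ends of the tower -/

section Preliminaries

variable {G : Type*} [AddCommGroup G]

theorem finrank_quotient_submoduleOf_add_finrank [Module.Finite ℤ G] {H K : AddSubgroup G}
    (hHK : H ≤ K) :
    Module.finrank ℤ (K.toIntSubmodule ⧸ H.toIntSubmodule.submoduleOf K.toIntSubmodule) +
      Module.finrank ℤ H.toIntSubmodule = Module.finrank ℤ K.toIntSubmodule := by
  have hHK' : H.toIntSubmodule ≤ K.toIntSubmodule := hHK
  rw [← (Submodule.submoduleOfEquivOfLe hHK').finrank_eq]
  exact Submodule.finrank_quotient_add_finrank _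

/-- Dickson's lemma: lifted to exponent vectors in `Fin n → ℕ`, the minimal elements form an
antichain, which is finite by well-quasi-ordering. -/
theorem exists_finite_sub_mem_closure {n : ℕ} (x : Fin n → G) {S : Set G}
    (hS : S ⊆ AddSubmonoid.closure (Set.range x)) :
    ∃ F ⊆ S, F.Finite ∧ ∀ s ∈ S, ∃ m ∈ F, s - m ∈ AddSubmonoid.closure (Set.range x) := by
  let φ : (Fin n → ℕ) → G := fun a => ∑ i, a i • x i
  have hφ : ∀ a, φ a ∈ AddSubmonoid.closure (Set.range x) := fun a =>
    sum_mem fun i _ => nsmul_mem (AddSubmonoid.subset_closure (Set.mem_range_self i)) _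
  have hsurj : ∀ s ∈ AddSubmonoid.closure (Set.range x), ∃ a, φ a = s := by
    classical
    intro s hs
    induction hs using AddSubmonoid.closure_induction with
    | mem s hs =>
      obtain ⟨i, rfl⟩ := hs
      exact ⟨Pi.single i 1, by simp [φ]⟩
    | zero => exact ⟨0, by simp [φ]⟩
    | add s t _ _ hs ht =>
      obtain ⟨a, rfl⟩ := hs
      obtain ⟨b, rfl⟩ := ht
      exact ⟨a + b, by simp [φ, add_smul, Finset.sum_add_distrib]⟩
  refine ⟨φ '' {a | Minimal (fun a => φ a ∈ S) a}, ?_, ?_, ?_⟩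
  · rintro _ ⟨a, ha, rfl⟩
    exact ha.1
  · exact (WellQuasiOrderedLE.finite_of_isAntichain (setOfPred_minimal_antichain _)).image _
  · intro s hs
    obtain ⟨a, rfl⟩ := hsurj s (hS hs)
    obtain ⟨b, hba, hb⟩ := exists_minimal_le_of_wellFoundedLT (fun a => φ a ∈ S) a hs
    refine ⟨φ b, ⟨b, hb, rfl⟩, ?_⟩
    have : φ a - φ b = φ (a - b) := by
      simp only [φ, ← Finset.sum_sub_distrib]
      refine Finset.sum_congr rfl fun i _ => ?_
      rw [sub_eq_iff_eq_add, ← add_smul, Pi.sub_apply, Nat.sub_add_cancel (hba i)]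
    rw [this]
    exact hφ _

variable [LinearOrder G] {n : ℕ} {Lhat : Fin (n + 1) → AddSubgroup G}

theorem IsIsolatedTower.isIsolated (hL : IsIsolatedTower Lhat) (k : Fin (n + 1)) :
    IsIsolated (Lhat k) :=
  (hL.2 _).2 ⟨k, rfl⟩

theorem IsIsolatedTower.last_eq_top (hL : IsIsolatedTower Lhat) : Lhat (Fin.last n) = ⊤ := by
  obtain ⟨k, hk⟩ := (hL.2 ⊤).1 fun _ _ _ _ _ => AddSubgroup.mem_top _
  exact top_unique (hk ▸ hL.1.monotone (Fin.le_last k))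

theorem IsIsolatedTower.zero_eq_bot (hL : IsIsolatedTower Lhat) : Lhat 0 = ⊥ := by
  obtain ⟨k, hk⟩ := (hL.2 ⊥).1 fun g₁ g₂ h₁ h₂ h => by
    rw [AddSubgroup.mem_bot] at h
    exact absurd (h₁.trans h₂) (by simp [h])
  exact bot_unique (hk ▸ hL.1.monotone (Fin.zero_le k))

theorem IsIsolatedTower.pos_of_ncard (hL : IsIsolatedTower Lhat) {x : Fin n → G}
    (hx : ∀ k : Fin (n + 1), {i : Fin n | x i ∈ Lhat k ∧ 0 < x i}.ncard = (k : ℕ)) (i : Fin n) :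
    0 < x i := by
  have h := hx (Fin.last n)
  rw [hL.last_eq_top] at h
  have huniv : {i : Fin n | x i ∈ (⊤ : AddSubgroup G) ∧ 0 < x i} = Set.univ := by
    exact Set.eq_of_subset_of_ncard_le (Set.subset_univ _) (by
      rw [h]
      simp [Set.ncard_univ])
  exact (huniv ▸ Set.mem_univ i : i ∈ {i : Fin n | x i ∈ (⊤ : AddSubgroup G) ∧ 0 < x i}).2

end Preliminaries

/-! ### Ranks of isolated subgroups and construction of simple cones -/

section Cones

variable {G : Type*} [AddCommGroup G] [LinearOrder G] [IsOrderedAddMonoid G]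

theorem IsIsolated.mem_of_abs_le {H : AddSubgroup G} (hH : IsIsolated H) {g h : G}
    (hgh : |g| ≤ |h|) (hh : h ∈ H) : g ∈ H := by
  rw [← abs_mem_iff] at hh ⊢
  rcases hgh.eq_or_lt with heq | hlt
  · rwa [heq]
  · rcases (abs_nonneg g).eq_or_lt with h0 | h0
    · rw [← h0]; exact H.zero_mem
    · exact hH _ _ h0 hlt hh

theorem IsIsolated.mem_of_zsmul_mem {H : AddSubgroup G} (hH : IsIsolated H) {m : ℤ} (hm : m ≠ 0)
    {g : G} (hg : m • g ∈ H) : g ∈ H := by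
  refine hH.mem_of_abs_le ?_ hg
  rw [abs_zsmul]
  have h1 : 1 ≤ |m| := Int.one_le_abs hm
  simpa using zsmul_le_zsmul_left (abs_nonneg g) h1

theorem IsIsolated.lt_of_notMem {H : AddSubgroup G} (hH : IsIsolated H) {y l : G} (hy : 0 < y)
    (hyH : y ∉ H) (hl : l ∈ H) : l < y := by
  by_contra! h
  exact hyH (hH.mem_of_abs_le (by rwa [abs_of_pos hy, abs_of_nonneg (hy.le.trans h)]) hl)

theorem IsIsolated.isTorsionFree_quotient {H K : AddSubgroup G} (hH : IsIsolated H) :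
    Module.IsTorsionFree ℤ (K.toIntSubmodule ⧸
      H.toIntSubmodule.submoduleOf K.toIntSubmodule) := by
  rw [Module.isTorsionFree_iff_smul_eq_zero]
  intro m q hq
  induction q using Submodule.Quotient.induction_on with
  | H z =>
    rw [← Submodule.Quotient.mk_smul, Submodule.Quotient.mk_eq_zero] at hq
    rw [Submodule.Quotient.mk_eq_zero]
    by_cases hm : m = 0
    · exact Or.inl hm
    · exact Or.inr (hH.mem_of_zsmul_mem hm hq)

theorem IsIsolated.finrank_lt [Module.Finite ℤ G] {H K : AddSubgroup G} (hH : IsIsolated H)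
    (hHK : H < K) :
    Module.finrank ℤ H.toIntSubmodule < Module.finrank ℤ K.toIntSubmodule := by
  have := hH.isTorsionFree_quotient (K := K)
  obtain ⟨hle, y, hyK, hyH⟩ := SetLike.lt_iff_le_and_exists.1 hHK
  have : Nontrivial (K.toIntSubmodule ⧸ H.toIntSubmodule.submoduleOf K.toIntSubmodule) := by
    refine ⟨⟨Submodule.Quotient.mk ⟨y, hyK⟩, 0, fun h => hyH ?_⟩⟩
    rw [Submodule.Quotient.mk_eq_zero] at h
    exact h
  have hpos := Module.finrank_pos (R := ℤ)
    (M := K.toIntSubmodule ⧸ H.toIntSubmodule.submoduleOf K.toIntSubmodule)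
  have := finrank_quotient_submoduleOf_add_finrank hle
  omega

/-- The quotient is torsion-free of rank one, hence infinite cyclic; a lift of its generator, with
the right sign, serves as `y`. -/
theorem IsIsolated.exists_generator [Module.Finite ℤ G] {H K : AddSubgroup G} (hH : IsIsolated H)
    (hHK : H < K)
    (hrank : Module.finrank ℤ K.toIntSubmodule = Module.finrank ℤ H.toIntSubmodule + 1) :
    ∃ y ∈ K, y ∉ H ∧ 0 < y ∧ ∀ z ∈ K, ∃ m : ℤ, z - m • y ∈ H := by
  have := hH.isTorsionFree_quotient (K := K)
  obtain ⟨hle, y₁, hy₁K, hy₁H⟩ := SetLike.lt_iff_le_and_exists.1 hHK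
  have hone : Module.finrank ℤ
      (K.toIntSubmodule ⧸ H.toIntSubmodule.submoduleOf K.toIntSubmodule) = 1 := by
    have := finrank_quotient_submoduleOf_add_finrank hle
    omega
  obtain ⟨b⟩ := (finrank_eq_one_iff Unit).1 hone
  obtain ⟨⟨y, hyK⟩, hy⟩ := Submodule.Quotient.mk_surjective _ (b ())
  have key : ∀ z ∈ K, ∃ m : ℤ, z - m • y ∈ H := by
    intro z hz
    refine ⟨b.repr (Submodule.Quotient.mk ⟨z, hz⟩) (), ?_⟩
    have h := b.sum_repr (Submodule.Quotient.mk ⟨z, hz⟩)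
    rw [Fintype.sum_unique, PUnit.default_eq_unit, ← hy, ← Submodule.Quotient.mk_smul, eq_comm,
      Submodule.Quotient.eq] at h
    exact h
  have hyH : y ∉ H := by
    intro hyH
    obtain ⟨m, hm⟩ := key y₁ hy₁K
    exact hy₁H (by simpa using H.add_mem hm (H.zsmul_mem hyH m))
  have hy0 : y ≠ 0 := fun h => hyH (h ▸ H.zero_mem)
  rcases lt_or_gt_of_ne hy0 with hneg | hpos
  · refine ⟨-y, K.neg_mem hyK, by simpa using hyH, by simpa using hneg, fun z hz => ?_⟩
    obtain ⟨m, hm⟩ := key z hz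
    exact ⟨-m, by simpa using hm⟩
  · exact ⟨y, hyK, hyH, hpos, key⟩

variable {n : ℕ} {Lhat : Fin (n + 1) → AddSubgroup G}

/-- Strict inclusions of isolated subgroups raise the rank, and `n + 1` strictly increasing values
in `{0, …, n}` leave no gap. -/
theorem IsIsolatedTower.finrank_eq [Module.Finite ℤ G] (hL : IsIsolatedTower Lhat)
    (hn : Module.finrank ℤ G = n) (k : Fin (n + 1)) :
    Module.finrank ℤ (Lhat k).toIntSubmodule = k := by
  have hmono : StrictMono fun k => Module.finrank ℤ (Lhat k).toIntSubmodule := fun i j hij =>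
    (hL.isIsolated i).finrank_lt (hL.1 hij)
  have hle : ∀ k, Module.finrank ℤ (Lhat k).toIntSubmodule < n + 1 := fun k =>
    Nat.lt_succ_of_le (hn ▸ Submodule.finrank_le _)
  have hmono' : StrictMono fun k => (⟨_, hle k⟩ : Fin (n + 1)) := fun i j hij => hmono hij
  have := hmono'.range_inj (g := (id : Fin (n + 1) → Fin (n + 1))) strictMono_id |>.1 (by
    rw [Set.range_id, Set.range_eq_univ]
    exact Finite.surjective_of_injective hmono'.injective)
  exact congrArg Fin.val (congrFun this k)

theorem IsIsolatedTower.exists_generator [Module.Finite ℤ G] (hL : IsIsolatedTower Lhat)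
    (hn : Module.finrank ℤ G = n) (k : Fin n) :
    ∃ y ∈ Lhat k.succ, y ∉ Lhat k.castSucc ∧ 0 < y ∧
      ∀ z ∈ Lhat k.succ, ∃ m : ℤ, z - m • y ∈ Lhat k.castSucc :=
  (hL.isIsolated _).exists_generator (hL.1 k.castSucc_lt_succ) (by simp [hL.finrank_eq hn])

/-- Every finite set of nonnegative elements of the `k`-th isolated subgroup lies in the semigroup
generated by a basis of this subgroup that is adapted to the tower. -/
theorem IsIsolatedTower.exists_adapted_family [Module.Finite ℤ G] (hL : IsIsolatedTower Lhat)
    (hn : Module.finrank ℤ G = n) (k : ℕ) (hk : k < n + 1) (S : Finset G)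
    (hS : ∀ s ∈ S, s ∈ Lhat ⟨k, hk⟩) (hS0 : ∀ s ∈ S, 0 ≤ s) :
    ∃ x : Fin k → G, LinearIndependent ℤ x ∧
      Submodule.span ℤ (Set.range x) = (Lhat ⟨k, hk⟩).toIntSubmodule ∧
      (∀ i, 0 < x i) ∧ (∀ i j, x i ∈ Lhat j ↔ k ≤ i + j) ∧
      ∀ s ∈ S, s ∈ AddSubmonoid.closure (Set.range x) := by
  classical
  induction k generalizing S with
  | zero =>
    have hbot : Lhat ⟨0, hk⟩ = ⊥ := hL.zero_eq_bot
    refine ⟨Fin.elim0, linearIndependent_empty_type, ?_, fun i => i.elim0, fun i => i.elim0, ?_⟩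
    · rw [hbot]; simp
    · intro s hs
      have := hS s hs
      rw [hbot, AddSubgroup.mem_bot] at this
      rw [this]; exact zero_mem _
  | succ k ih =>
    have hk' : k < n + 1 := by omega
    set H := Lhat ⟨k, hk'⟩ with hH
    obtain ⟨y, hyK, hyH, hy0, hgen⟩ := hL.exists_generator hn ⟨k, by omega⟩
    change y ∈ Lhat ⟨k + 1, hk⟩ at hyK
    change y ∉ H at hyH
    change ∀ z ∈ Lhat ⟨k + 1, hk⟩, ∃ m : ℤ, z - m • y ∈ H at hgen
    have hisol : IsIsolated H := hL.isIsolated _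
    choose! m hm using hgen
    -- If `m s ≤ -1`, then `s + y ≤ s - m s • y`, an element of `H` and so less than `y`; this
    -- contradicts `0 ≤ s`.
    have hm0 : ∀ s ∈ S, 0 ≤ m s := by
      intro s hs
      by_contra! hlt
      have h2 : s - m s • y < y := hisol.lt_of_notMem hy0 hyH (hm s (hS s hs))
      have h3 : y ≤ (-m s) • y := by
        simpa using zsmul_le_zsmul_left hy0.le (show 1 ≤ -m s by omega)
      rw [neg_zsmul] at h3
      have h4 : s + y ≤ s - m s • y := by rw [sub_eq_add_neg]; gcongr
      exact absurd (h4.trans_lt h2) (by simpa using hS0 s hs)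
    -- The new generator is `y - l`: subtracting an element of `H` keeps it positive and generating
    -- modulo `H`, while `l` is large enough to make every remainder `s - m s • (y - l)`
    -- nonnegative. The induction hypothesis then applies to these remainders.
    set l : G := ∑ s ∈ S, |s - m s • y| with hl
    have hlH : l ∈ H := sum_mem fun s hs => abs_mem_iff.2 (hm s (hS s hs))
    have hl0 : 0 ≤ l := Finset.sum_nonneg fun s _ => abs_nonneg _
    have hly : l < y := hisol.lt_of_notMem hy0 hyH hlH
    have hrem : ∀ s ∈ S, s - m s • (y - l) ∈ H ∧ 0 ≤ s - m s • (y - l) := by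
      intro s hs
      have heq : s - m s • (y - l) = (s - m s • y) + m s • l := by rw [zsmul_sub]; abel
      refine ⟨heq ▸ H.add_mem (hm s (hS s hs)) (H.zsmul_mem hlH _), ?_⟩
      rcases (hm0 s hs).eq_or_lt with h0 | h0
      · simpa [← h0] using hS0 s hs
      · have h1 : |s - m s • y| ≤ l :=
          Finset.single_le_sum (f := fun s => |s - m s • y|) (fun s _ => abs_nonneg _) hs
        have h2 : l ≤ m s • l := by simpa using zsmul_le_zsmul_left hl0 (show 1 ≤ m s by omega)
        rw [heq]
        have h3 := neg_le_of_abs_le (h1.trans h2)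
        exact neg_le_iff_add_nonneg.1 h3
    obtain ⟨x, hli, hspan, hx0, hxmem, hxS⟩ := ih hk' (S.image fun s => s - m s • (y - l))
      (by simpa using fun s hs => (hrem s hs).1) (by simpa using fun s hs => (hrem s hs).2)
    have hy'H : y - l ∉ H := fun h => hyH (by simpa using H.add_mem h hlH)
    have hHK : H ≤ Lhat ⟨k + 1, hk⟩ := hL.1.monotone (by simp [Fin.le_def])
    have hy'K : y - l ∈ Lhat ⟨k + 1, hk⟩ := sub_mem hyK (hHK hlH)
    refine ⟨Fin.cons (y - l) x, ?_, ?_, ?_, ?_, ?_⟩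
    · refine hli.finCons' _ _ fun c z hz hcz => ?_
      by_contra hc
      rw [hspan] at hz
      refine hy'H (hisol.mem_of_zsmul_mem hc ?_)
      rw [eq_neg_of_add_eq_zero_left hcz]
      exact H.neg_mem hz
    · rw [Fin.range_cons]
      refine le_antisymm (Submodule.span_le.2 (Set.insert_subset hy'K ?_)) ?_
      · rintro z hz
        have : z ∈ Submodule.span ℤ (Set.range x) := Submodule.subset_span hz
        rw [hspan] at this
        exact hHK this
      · intro z hz
        have h1 : z - m z • (y - l) ∈ Submodule.span ℤ (Set.range x) := by
          rw [hspan, zsmul_sub, ← sub_add]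
          exact H.add_mem (hm z hz) (H.zsmul_mem hlH _)
        rw [Submodule.mem_span_insert]
        exact ⟨m z, _, h1, by abel⟩
    · refine Fin.cases ?_ ?_
      · simpa using hly
      · simpa using hx0
    · intro i j
      refine Fin.cases ?_ (fun i => ?_) i
      · simp only [Fin.cons_zero, Fin.val_zero, zero_add]
        constructor
        · intro h
          by_contra! hlt
          exact hy'H (hL.1.monotone (show j ≤ ⟨k, hk'⟩ from Fin.le_def.2 (by simp; omega)) h)
        · intro h
          exact hL.1.monotone (Fin.le_def.2 h) hy'K
      · simp only [Fin.cons_succ, Fin.val_succ, hxmem]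
        omega
    · intro s hs
      rw [Fin.range_cons]
      have h1 := hxS _ (Finset.mem_image_of_mem _ hs)
      have h2 : s = (m s).toNat • (y - l) + (s - m s • (y - l)) := by
        rw [← natCast_zsmul, Int.toNat_of_nonneg (hm0 s hs)]; abel
      rw [h2]
      exact add_mem (nsmul_mem (AddSubmonoid.subset_closure (Set.mem_insert _ _)) _)
        (AddSubmonoid.closure_mono (Set.subset_insert _ _) h1)

/-- Every finite set of nonnegative elements lies in a simple cone. -/
theorem IsIsolatedTower.exists_simpleCone [Module.Finite ℤ G] (hL : IsIsolatedTower Lhat)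
    (hn : Module.finrank ℤ G = n) {S : Set G} (hfin : S.Finite) (hS0 : ∀ s ∈ S, 0 ≤ s) :
    ∃ C ∈ simpleCones Lhat, S ⊆ C := by
  have htop : Lhat ⟨n, n.lt_succ_self⟩ = ⊤ := hL.last_eq_top
  obtain ⟨x, hli, hspan, hx0, hxmem, hxS⟩ := hL.exists_adapted_family hn n n.lt_succ_self
    hfin.toFinset (fun s _ => by rw [htop]; exact AddSubgroup.mem_top s) (by simpa using hS0)
  rw [htop] at hspan
  refine ⟨_, ⟨Module.Basis.mk hli (by rw [hspan]; exact fun _ _ => AddSubgroup.mem_top _), rfl,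
    fun k => ?_⟩, ?_⟩
  · simp only [Module.Basis.coe_mk, hx0, hxmem, and_true]
    -- The family is numbered from the top of the tower down, since each new generator was put at
    -- index 0.
    have : {i : Fin n | n ≤ i + k} = Fin.rev '' {i : Fin n | (i : ℕ) < k} := by
      ext i
      constructor
      · intro hi
        exact ⟨i.rev, by simp [Fin.val_rev] at hi ⊢; omega, i.rev_rev⟩
      · rintro ⟨j, hj, rfl⟩
        simp [Fin.val_rev] at hj ⊢
        omega
    rw [this, Set.ncard_image_of_injective _ Fin.rev_injective]
    have h2 : {i : Fin n | (i : ℕ) < k} = Fin.castLE (Nat.le_of_lt_succ k.2) '' Set.univ := by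
      ext i
      constructor
      · intro hi; exact ⟨⟨i, hi⟩, trivial, rfl⟩
      · rintro ⟨j, -, rfl⟩; exact j.2
    rw [h2, Set.ncard_image_of_injective _ (Fin.castLE_injective _), Set.ncard_univ]
    simp
  · intro s hs
    simpa using hxS s (by simpa using hs)

end Cones

/-! ### Weighted norms at points of the torus -/

section Weights

variable {G : Type*} [AddCommGroup G]

/-- The absolute value of the character `p` at the point `t` of the torus. -/
noncomputable def weight (t : Torus G) (p : G) : ℝ≥0∞ :=
  ‖(t (Multiplicative.ofAdd p) : ℂ)‖ₑ

theorem weight_zero (t : Torus G) : weight t 0 = 1 := by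
  simp [weight]

theorem weight_add (t : Torus G) (p q : G) : weight t (p + q) = weight t p * weight t q := by
  simp [weight, enorm_mul]

theorem weight_ne_top (t : Torus G) (p : G) : weight t p ≠ ∞ := enorm_ne_top

/-- The sum of the absolute values of the terms of the series `f` at the point `t`. -/
noncomputable def weightedNorm (t : Torus G) (f : G → ℂ) : ℝ≥0∞ :=
  ∑' p, ‖f p‖ₑ * weight t p

theorem convergesAt_iff {t : Torus G} {f : G → ℂ} :
    ConvergesAt f t ↔ weightedNorm t f ≠ ∞ := by
  simp only [ConvergesAt, weightedNorm, weight, ← enorm_mul]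
  rw [tsum_enorm_ne_top_iff_summable_norm, summable_norm_iff]

theorem weightedNorm_add_le (t : Torus G) (f g : G → ℂ) :
    weightedNorm t (f + g) ≤ weightedNorm t f + weightedNorm t g := by
  simp only [weightedNorm]
  rw [← ENNReal.tsum_add]
  refine ENNReal.tsum_le_tsum fun p => ?_
  rw [← add_mul]
  gcongr
  exact enorm_add_le _ _

/-- A `finsum` with infinite support is 0 by convention, so no finiteness assumption is needed. -/
theorem enorm_finsum_le_tsum {ι : Type*} (f : ι → ℂ) : ‖∑ᶠ i, f i‖ₑ ≤ ∑' i, ‖f i‖ₑ := by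
  by_cases hf : (Function.support f).Finite
  · rw [finsum_eq_sum f hf]
    exact (enorm_sum_le _ _).trans (ENNReal.sum_le_tsum _)
  · rw [finsum_of_infinite_support hf]
    simp

theorem weightedNorm_convolution_le (t : Torus G) (f g : G → ℂ) :
    weightedNorm t (fun p => ∑ᶠ q, f q * g (p - q)) ≤ weightedNorm t f * weightedNorm t g := by
  calc weightedNorm t (fun p => ∑ᶠ q, f q * g (p - q))
      ≤ ∑' p, ∑' q, (‖f q‖ₑ * weight t q) * (‖g (p - q)‖ₑ * weight t (p - q)) := by
        refine ENNReal.tsum_le_tsum fun p => ?_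
        calc _ ≤ (∑' q, ‖f q * g (p - q)‖ₑ) * weight t p := by
              gcongr
              exact enorm_finsum_le_tsum _
          _ = _ := by
              rw [← ENNReal.tsum_mul_right]
              refine tsum_congr fun q => ?_
              have : weight t p = weight t q * weight t (p - q) := by
                rw [← weight_add, add_sub_cancel]
              rw [this, enorm_mul]
              ring
    _ = ∑' q, (‖f q‖ₑ * weight t q) * weightedNorm t g := by
        rw [ENNReal.tsum_comm]
        refine tsum_congr fun q => ?_
        rw [ENNReal.tsum_mul_left]
        congr 1
        exact (Equiv.subRight q).tsum_eq fun p => ‖g p‖ₑ * weight t p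
    _ = weightedNorm t f * weightedNorm t g := ENNReal.tsum_mul_right

theorem weightedNorm_finsum_le {ι : Type*} (t : Torus G) (f : ι → G → ℂ) :
    weightedNorm t (fun p => ∑ᶠ i, f i p) ≤ ∑' i, weightedNorm t (f i) := by
  calc weightedNorm t (fun p => ∑ᶠ i, f i p)
      ≤ ∑' p, ∑' i, ‖f i p‖ₑ * weight t p := by
        refine ENNReal.tsum_le_tsum fun p => ?_
        rw [ENNReal.tsum_mul_right]
        gcongr
        exact enorm_finsum_le_tsum _
    _ = _ := ENNReal.tsum_comm

theorem weightedNorm_ne_top_of_finite_support (t : Torus G) {f : G → ℂ}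
    (hf : (Function.support f).Finite) : weightedNorm t f ≠ ∞ := by
  rw [weightedNorm, tsum_eq_sum (s := hf.toFinset) fun p hp => by
    have : f p = 0 := by simpa using hp
    simp [this]]
  exact ENNReal.sum_ne_top.2 fun p _ => ENNReal.mul_ne_top enorm_ne_top (weight_ne_top t p)

theorem exists_torus {n : ℕ} (x : Module.Basis (Fin n) ℤ G) (c : Fin n → ℂˣ) :
    ∃ t : Torus G, ∀ i, t (Multiplicative.ofAdd (x i)) = c i := by
  refine ⟨AddMonoidHom.toMultiplicativeLeft
    (x.constr ℤ fun i => Additive.ofMul (c i)).toAddMonoidHom, fun i => ?_⟩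
  have h := x.constr_basis ℤ (fun i => Additive.ofMul (c i)) i
  exact congrArg Additive.toMul h

theorem weight_le_of_mem_closure {r t : Torus G} {S : Set G}
    (h : ∀ s ∈ S, weight r s ≤ weight t s) {p : G} (hp : p ∈ AddSubmonoid.closure S) :
    weight r p ≤ weight t p := by
  induction hp using AddSubmonoid.closure_induction with
  | mem s hs => exact h s hs
  | zero => simp [weight_zero]
  | add p q _ _ hp hq => rw [weight_add, weight_add]; gcongr

/-- A nonzero element involves at least one generator and so gains a factor `ε`; further factors
only help because `ε ≤ 1`. -/
theorem weight_le_mul_of_mem_closure {r t : Torus G} {S : Set G} {ε : ℝ≥0∞} (hε : ε ≤ 1)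
    (h : ∀ s ∈ S, weight r s ≤ ε * weight t s) {p : G} (hp : p ∈ AddSubmonoid.closure S) :
    p = 0 ∨ weight r p ≤ ε * weight t p := by
  induction hp using AddSubmonoid.closure_induction with
  | mem s hs => exact Or.inr (h s hs)
  | zero => exact Or.inl rfl
  | add p q _ _ hp hq =>
    rcases hp with rfl | hp
    · simpa using hq
    rcases hq with rfl | hq
    · simpa using Or.inr hp
    right
    calc weight r (p + q) = weight r p * weight r q := weight_add _ _ _
      _ ≤ (ε * weight t p) * (1 * weight t q) := by
          gcongr
          exact hq.trans (by gcongr)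
      _ = ε * weight t (p + q) := by rw [weight_add]; ring

theorem SupportedIn.mono {f : G → ℂ} {C D : AddSubmonoid G} {p q : G}
    (hf : SupportedIn f C p) (hCD : C ≤ D) (hpq : p - q ∈ D) : SupportedIn f D q := by
  intro r hr
  rw [← sub_add_sub_cancel r p q]
  exact D.add_mem (hCD (hf r hr)) hpq

theorem weightedNorm_ne_top_of_weight_le {r t : Torus G} {f : G → ℂ} {C : AddSubmonoid G} {p₀ : G}
    (hf : SupportedIn f C p₀) (h : ∀ p ∈ C, weight r p ≤ weight t p)
    (ht : weightedNorm t f ≠ ∞) : weightedNorm r f ≠ ∞ := by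
  have hle : weightedNorm r f ≤ weightedNorm t f * (weight t (-p₀) * weight r p₀) := by
    rw [weightedNorm, weightedNorm, ← ENNReal.tsum_mul_right]
    refine ENNReal.tsum_le_tsum fun p => ?_
    by_cases hp : f p = 0
    · simp [hp]
    · rw [mul_assoc]
      gcongr
      calc weight r p = weight r (p - p₀) * weight r p₀ := by rw [← weight_add, sub_add_cancel]
        _ ≤ weight t (p - p₀) * weight r p₀ := by gcongr; exact h _ (hf p hp)
        _ = weight t p * (weight t (-p₀) * weight r p₀) := by
          rw [sub_eq_add_neg, weight_add, mul_assoc]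
  exact ne_top_of_le_ne_top
    (ENNReal.mul_ne_top ht (ENNReal.mul_ne_top (weight_ne_top _ _) (weight_ne_top _ _))) hle

theorem exists_weight_le {n : ℕ} (x : Module.Basis (Fin n) ℤ G) (s t : Torus G) :
    ∃ r : Torus G, ∀ p ∈ AddSubmonoid.closure (Set.range x),
      weight r p ≤ weight s p ∧ weight r p ≤ weight t p := by
  classical
  -- On each basis element, `r` takes the value of whichever of `s`, `t` is smaller in modulus.
  obtain ⟨r, hr⟩ := exists_torus x fun i =>
    if weight s (x i) ≤ weight t (x i) then s (Multiplicative.ofAdd (x i))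
    else t (Multiplicative.ofAdd (x i))
  have key : ∀ i, weight r (x i) ≤ weight s (x i) ∧ weight r (x i) ≤ weight t (x i) := by
    intro i
    by_cases h : weight s (x i) ≤ weight t (x i)
    · have : weight r (x i) = weight s (x i) := by
        rw [weight, hr i, if_pos h, weight]
      exact ⟨this.le, this.le.trans h⟩
    · have : weight r (x i) = weight t (x i) := by
        rw [weight, hr i, if_neg h, weight]
      exact ⟨this.le.trans (not_le.1 h).le, this.le⟩
  refine ⟨r, fun p hp => ⟨weight_le_of_mem_closure ?_ hp, weight_le_of_mem_closure ?_ hp⟩⟩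
  · rintro _ ⟨i, rfl⟩; exact (key i).1
  · rintro _ ⟨i, rfl⟩; exact (key i).2

theorem exists_weight_le_mul {n : ℕ} (x : Module.Basis (Fin n) ℤ G) (t : Torus G) {ε : ℝ≥0}
    (hε0 : ε ≠ 0) (hε : ε ≤ 1) :
    ∃ r : Torus G, ∀ p ∈ AddSubmonoid.closure (Set.range x),
      p = 0 ∨ weight r p ≤ ε * weight t p := by
  obtain ⟨r, hr⟩ := exists_torus x fun i =>
    Units.mk0 ((ε : ℝ) : ℂ) (by simpa using hε0) * t (Multiplicative.ofAdd (x i))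
  refine ⟨r, fun p hp => weight_le_mul_of_mem_closure (by simpa using hε) ?_ hp⟩
  rintro _ ⟨i, rfl⟩
  have h : ‖((ε : ℝ) : ℂ)‖ₑ = ε := by
    rw [enorm_eq_nnnorm]
    congr 1
    ext
    simp
  simp only [weight]
  rw [hr i, Units.val_mul, Units.val_mk0, enorm_mul, h]

/-- If `f` is supported in a simple cone and has no constant term, then its norm is small
at a suitable point of the torus. -/
theorem exists_weightedNorm_le_half {n : ℕ} (x : Module.Basis (Fin n) ℤ G) {t : Torus G}
    {f : G → ℂ} (hf : SupportedIn f (AddSubmonoid.closure (Set.range x)) 0) (hf0 : f 0 = 0)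
    (ht : weightedNorm t f ≠ ∞) : ∃ r : Torus G, weightedNorm r f ≤ 2⁻¹ := by
  lift weightedNorm t f to ℝ≥0 using ht with N hN
  -- This `ε` gives `ε * N ≤ 1/2`; the `+ 1` covers `N = 0` and ensures `ε ≤ 1`.
  have hε : (2 * (N + 1))⁻¹ ≤ (1 : ℝ≥0) := inv_le_one_of_one_le₀ (by
    nlinarith [N.2])
  obtain ⟨r, hr⟩ := exists_weight_le_mul x t (ε := (2 * (N + 1))⁻¹) (by positivity) hε
  refine ⟨r, ?_⟩
  calc weightedNorm r f ≤ ∑' p, ((2 * (N + 1))⁻¹ : ℝ≥0) * (‖f p‖ₑ * weight t p) := by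
        refine ENNReal.tsum_le_tsum fun p => ?_
        by_cases hp : f p = 0
        · simp [hp]
        · have hp0 : p ≠ 0 := fun h => hp (h ▸ hf0)
          rw [mul_left_comm]
          gcongr
          exact (hr p (by simpa using hf p hp)).resolve_left hp0
    _ = (((2 * (N + 1))⁻¹ * N : ℝ≥0) : ℝ≥0∞) := by
        rw [ENNReal.tsum_mul_left, ENNReal.coe_mul, hN, weightedNorm]
    _ ≤ 2⁻¹ := by
        have h : (2 * (N + 1))⁻¹ * N ≤ (2 : ℝ≥0)⁻¹ := by
          rw [mul_inv, mul_assoc]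
          refine mul_le_of_le_one_right (by positivity) ?_
          rw [inv_mul_le_one₀ (by positivity)]
          exact le_self_add
        calc _ ≤ (((2 : ℝ≥0)⁻¹ : ℝ≥0) : ℝ≥0∞) := by exact_mod_cast h
          _ = 2⁻¹ := by simp

end Weights

/-! ### Common cones, sums and products of Laurent series -/

section Laurent

variable {G : Type*} [AddCommGroup G] [LinearOrder G] {n : ℕ}

/-- The series with a point of convergence and with support in a shifted simple cone. -/
def IsLaurent (Lhat : Fin (n + 1) → AddSubgroup G) (f : G → ℂ) : Prop :=
  (∃ t : Torus G, weightedNorm t f ≠ ∞) ∧ ∃ C ∈ simpleCones Lhat, ∃ p₀ : G, SupportedIn f C p₀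

variable {Lhat : Fin (n + 1) → AddSubgroup G}

theorem mem_laurentStar_iff {f : G → ℂ} : f ∈ laurentStar Lhat ↔ f ≠ 0 ∧ IsLaurent Lhat f := by
  simp only [laurentStar, IsLaurent, convergesAt_iff, Set.mem_ofPred_eq]

variable [IsOrderedAddMonoid G]

theorem IsIsolatedTower.isPWO_of_mem_simpleCones (hL : IsIsolatedTower Lhat) {C : AddSubmonoid G}
    (hC : C ∈ simpleCones Lhat) : (C : Set G).IsPWO := by
  obtain ⟨x, rfl, hx⟩ := hC
  refine Set.IsPWO.addSubmonoid_closure ?_ (Set.finite_range x).isPWO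
  rintro _ ⟨i, rfl⟩
  exact (hL.pos_of_ncard hx i).le

theorem IsLaurent.isPWO_support (hL : IsIsolatedTower Lhat) {f : G → ℂ} (hf : IsLaurent Lhat f) :
    (Function.support f).IsPWO := by
  obtain ⟨-, C, hC, p₀, hf⟩ := hf
  refine ((hL.isPWO_of_mem_simpleCones hC).image_of_monotone
    (f := fun p => p + p₀) fun a b h => by dsimp only; gcongr).mono fun p hp => ?_
  exact ⟨p - p₀, hf p hp, sub_add_cancel _ _⟩

/-- Only the finitely many pairs in the antidiagonal of the two supports contribute to the
convolution. -/
theorem coeff_mul_eq_finsum (f g : HahnSeries G ℂ) (p : G) :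
    (Function.support fun q : G => f.coeff q * g.coeff (p - q)).Finite ∧
      (f * g).coeff p = ∑ᶠ q : G, f.coeff q * g.coeff (p - q) := by
  classical
  set A := Finset.antidiagonal f.isPWO_support g.isPWO_support p with hA
  have hsub : (Function.support fun q : G => f.coeff q * g.coeff (p - q)) ⊆
      (A.image Prod.fst : Finset G) := by
    intro q hq
    rw [Finset.mem_coe, Finset.mem_image]
    refine ⟨(q, p - q), ?_, rfl⟩
    rw [hA, Finset.mem_antidiagonal]
    exact ⟨left_ne_zero_of_mul hq, right_ne_zero_of_mul hq, add_sub_cancel _ _⟩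
  refine ⟨(Finset.finite_toSet _).subset hsub, ?_⟩
  have hsum : ∀ ij ∈ A, ij.2 = p - ij.1 := fun ij hij => by
    rw [hA, Finset.mem_antidiagonal] at hij
    rw [← hij.2.2, add_sub_cancel_left]
  rw [finsum_eq_sum_of_support_subset _ hsub, Finset.sum_image fun a ha b hb hab =>
    Prod.ext hab (by rw [hsum a ha, hsum b hb, hab]), coeff_mul]
  exact Finset.sum_congr rfl fun ij hij => by rw [hsum ij hij]

variable [Module.Finite ℤ G]

/-- If the support of `f` is bounded below by `p₁`, then it lies in a simple cone with
vertex `p₁`. -/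
theorem IsLaurent.exists_supportedIn_of_le (hL : IsIsolatedTower Lhat)
    (hn : Module.finrank ℤ G = n) {f : G → ℂ} (hf : IsLaurent Lhat f) {p₁ : G}
    (hp₁ : ∀ p, f p ≠ 0 → p₁ ≤ p) : ∃ C ∈ simpleCones Lhat, SupportedIn f C p₁ := by
  obtain ⟨-, _, ⟨x, rfl, hx⟩, p₀, hf⟩ := hf
  obtain ⟨F, hFS, hF, hmin⟩ := exists_finite_sub_mem_closure x
    (S := (fun p => p - p₀) '' Function.support f) (by rintro _ ⟨p, hp, rfl⟩; exact hf p hp)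
  -- The new cone holds the old generators and the finitely many minimal support points measured
  -- from `p₁`; every other support point is one of these plus an element of the old cone.
  obtain ⟨C, hC, hSC⟩ := hL.exists_simpleCone hn
    (S := (fun m => m + p₀ - p₁) '' F ∪ Set.range x) ((hF.image _).union (Set.finite_range x)) (by
      rintro _ (⟨m, hm, rfl⟩ | ⟨i, rfl⟩)
      · obtain ⟨p, hp, rfl⟩ := hFS hm
        simpa using hp₁ p hp
      · exact (hL.pos_of_ncard hx i).le)
  refine ⟨C, hC, fun p hp => ?_⟩
  obtain ⟨m, hm, hpm⟩ := hmin (p - p₀) ⟨p, hp, rfl⟩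
  have h1 : p - p₀ - m ∈ C :=
    AddSubmonoid.closure_le.2 (Set.subset_union_right.trans hSC) hpm
  have h2 : m + p₀ - p₁ ∈ C := hSC (Or.inl ⟨m, hm, rfl⟩)
  have h3 : p - p₁ = (p - p₀ - m) + (m + p₀ - p₁) := by abel
  exact h3 ▸ C.add_mem h1 h2

/-- Two series have a common shifted simple cone containing their supports and a common point
of convergence. -/
theorem IsLaurent.exists_common (hL : IsIsolatedTower Lhat) (hn : Module.finrank ℤ G = n)
    {f g : G → ℂ} (hf : IsLaurent Lhat f) (hg : IsLaurent Lhat g) :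
    ∃ C ∈ simpleCones Lhat, ∃ p₀ : G, SupportedIn f C p₀ ∧ SupportedIn g C p₀ ∧
      ∃ t : Torus G, weightedNorm t f ≠ ∞ ∧ weightedNorm t g ≠ ∞ := by
  obtain ⟨⟨s, hs⟩, _, ⟨x, rfl, hx⟩, p, hfp⟩ := hf
  obtain ⟨⟨t, ht⟩, _, ⟨y, rfl, hy⟩, q, hgq⟩ := hg
  obtain ⟨C, hC, hSC⟩ := hL.exists_simpleCone hn
    (S := Set.range x ∪ Set.range y ∪ {p - min p q, q - min p q})
    (((Set.finite_range x).union (Set.finite_range y)).union (by simp)) (by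
      rintro _ ((⟨i, rfl⟩ | ⟨i, rfl⟩) | rfl | rfl)
      · exact (hL.pos_of_ncard hx i).le
      · exact (hL.pos_of_ncard hy i).le
      · simp
      · simp)
  have hfC : SupportedIn f C (min p q) := hfp.mono
    (AddSubmonoid.closure_le.2 fun z hz => hSC (by simp [hz])) (hSC (by simp))
  have hgC : SupportedIn g C (min p q) := hgq.mono
    (AddSubmonoid.closure_le.2 fun z hz => hSC (by simp [hz])) (hSC (by simp))
  refine ⟨C, hC, min p q, hfC, hgC, ?_⟩
  obtain ⟨z, rfl, -⟩ := hC
  obtain ⟨r, hr⟩ := exists_weight_le z s t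
  exact ⟨r, weightedNorm_ne_top_of_weight_le hfC (fun p hp => (hr p hp).1) hs,
    weightedNorm_ne_top_of_weight_le hgC (fun p hp => (hr p hp).2) ht⟩

theorem IsLaurent.add (hL : IsIsolatedTower Lhat) (hn : Module.finrank ℤ G = n)
    {f g : G → ℂ} (hf : IsLaurent Lhat f) (hg : IsLaurent Lhat g) : IsLaurent Lhat (f + g) := by
  obtain ⟨C, hC, p₀, hfC, hgC, t, hft, hgt⟩ := hf.exists_common hL hn hg
  refine ⟨⟨t, ne_top_of_le_ne_top (ENNReal.add_ne_top.2 ⟨hft, hgt⟩)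
    (weightedNorm_add_le t f g)⟩, C, hC, p₀, fun p hp => ?_⟩
  by_cases hfp : f p = 0
  · exact hgC p fun h => hp (by simp [hfp, h])
  · exact hfC p hfp

theorem IsLaurent.convolution (hL : IsIsolatedTower Lhat) (hn : Module.finrank ℤ G = n)
    {f g : G → ℂ} (hf : IsLaurent Lhat f) (hg : IsLaurent Lhat g) :
    IsLaurent Lhat fun p => ∑ᶠ q, f q * g (p - q) := by
  obtain ⟨C, hC, p₀, hfC, hgC, t, hft, hgt⟩ := hf.exists_common hL hn hg
  refine ⟨⟨t, ne_top_of_le_ne_top (ENNReal.mul_ne_top hft hgt)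
    (weightedNorm_convolution_le t f g)⟩, C, hC, p₀ + p₀, fun p hp => ?_⟩
  obtain ⟨q, hq⟩ : ∃ q, f q * g (p - q) ≠ 0 := by
    by_contra! h
    exact hp (by simp only [h, finsum_zero])
  have h1 := hfC q (left_ne_zero_of_mul hq)
  have h2 := hgC _ (right_ne_zero_of_mul hq)
  have h3 : p - (p₀ + p₀) = (q - p₀) + (p - q - p₀) := by abel
  exact h3 ▸ C.add_mem h1 h2

theorem isLaurent_of_support_subset_singleton (hL : IsIsolatedTower Lhat)
    (hn : Module.finrank ℤ G = n) {f : G → ℂ} {p₀ : G} (hf : Function.support f ⊆ {p₀}) :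
    IsLaurent Lhat f := by
  obtain ⟨C, hC, -⟩ := hL.exists_simpleCone hn (S := ∅) Set.finite_empty (by simp)
  refine ⟨⟨1, weightedNorm_ne_top_of_finite_support _ ((Set.finite_singleton p₀).subset hf)⟩,
    C, hC, p₀, fun p hp => ?_⟩
  have : p = p₀ := hf hp
  simp [this]

end Laurent

/-! ### Inverses, the subfield of Hahn series, and the valuation -/

section Field

variable {G : Type*} [AddCommGroup G] [LinearOrder G] [IsOrderedAddMonoid G] {n : ℕ}
  {Lhat : Fin (n + 1) → AddSubgroup G}

theorem weightedNorm_coeff_pow_le (t : Torus G) (h : HahnSeries G ℂ) (k : ℕ) :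
    weightedNorm t (h ^ k).coeff ≤ weightedNorm t h.coeff ^ k := by
  induction k with
  | zero =>
    rw [pow_zero, pow_zero, weightedNorm, tsum_eq_single 0 fun p hp => by simp [coeff_one, hp]]
    simp [coeff_one, weight_zero]
  | succ k ih =>
    have : (h ^ (k + 1)).coeff = fun p => ∑ᶠ q, (h ^ k).coeff q * h.coeff (p - q) := by
      ext p
      rw [pow_succ, (coeff_mul_eq_finsum _ _ p).2]
    rw [this, pow_succ]
    exact (weightedNorm_convolution_le _ _ _).trans (by gcongr)

theorem supportedIn_coeff_pow {C : AddSubmonoid G} {h : HahnSeries G ℂ}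
    (hC : SupportedIn h.coeff C 0) (k : ℕ) : SupportedIn (h ^ k).coeff C 0 := by
  intro p hp
  rw [sub_zero]
  refine AddSubmonoid.closure_le.2 (fun q hq => ?_)
    (SummableFamily.support_pow_subset_closure h k hp)
  simpa using hC q hq

variable [Module.Finite ℤ G]

/-- Positive order allows the cone to have vertex 0, so it contains the supports of all powers; at a
point where `h` has norm at most 1/2 the norms sum to at most 2. -/
theorem isLaurent_hsum_powers (hL : IsIsolatedTower Lhat) (hn : Module.finrank ℤ G = n)
    {h : HahnSeries G ℂ} (hh : IsLaurent Lhat h.coeff) (hpos : 0 < h.orderTop) :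
    IsLaurent Lhat (SummableFamily.powers h).hsum.coeff := by
  obtain ⟨C, hC, hsupp⟩ := hh.exists_supportedIn_of_le hL hn (p₁ := 0) fun p hp => by
    exact_mod_cast hpos.le.trans (orderTop_le_of_coeff_ne_zero hp)
  have h0 : h.coeff 0 = 0 := coeff_eq_zero_of_lt_orderTop hpos
  have hcoeff : (SummableFamily.powers h).hsum.coeff = fun p => ∑ᶠ k : ℕ, (h ^ k).coeff p := by
    ext p
    rw [SummableFamily.coeff_hsum, SummableFamily.coe_powers hpos]
  rw [hcoeff]
  refine ⟨?_, C, hC, 0, fun p hp => ?_⟩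
  · obtain ⟨t, ht⟩ := hh.1
    obtain ⟨x, rfl, -⟩ := hC
    obtain ⟨r, hr⟩ := exists_weightedNorm_le_half x hsupp h0 ht
    refine ⟨r, ne_top_of_le_ne_top (b := 2) (by simp) ?_⟩
    calc weightedNorm r (fun p => ∑ᶠ k : ℕ, (h ^ k).coeff p)
        ≤ ∑' k : ℕ, weightedNorm r (h ^ k).coeff := weightedNorm_finsum_le _ _
      _ ≤ ∑' k : ℕ, (2⁻¹ : ℝ≥0∞) ^ k := by
          refine ENNReal.tsum_le_tsum fun k => (weightedNorm_coeff_pow_le r h k).trans ?_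
          gcongr
      _ = 2 := by rw [ENNReal.tsum_geometric, ENNReal.one_sub_inv_two, inv_inv]
  · obtain ⟨k, hk⟩ : ∃ k : ℕ, (h ^ k).coeff p ≠ 0 := by
      by_contra! hzero
      exact hp (by simp only [hzero, finsum_zero])
    exact supportedIn_coeff_pow hsupp k p hk

/-- The Hahn series with a point of convergence and with support in a shifted simple cone. -/
noncomputable def laurentSubfield (hL : IsIsolatedTower Lhat) (hn : Module.finrank ℤ G = n) :
    Subfield (HahnSeries G ℂ) :=
  have hsingle (p : G) (c : ℂ) : IsLaurent Lhat (single p c).coeff :=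
    isLaurent_of_support_subset_singleton hL hn support_single_subset
  have hmul {f g : HahnSeries G ℂ} (hf : IsLaurent Lhat f.coeff) (hg : IsLaurent Lhat g.coeff) :
      IsLaurent Lhat (f * g).coeff := by
    have : (f * g).coeff = fun p => ∑ᶠ q, f.coeff q * g.coeff (p - q) :=
      funext fun p => (coeff_mul_eq_finsum f g p).2
    exact this ▸ hf.convolution hL hn hg
  have hneg {f : HahnSeries G ℂ} (hf : IsLaurent Lhat f.coeff) : IsLaurent Lhat (-f).coeff := by
    have : -f = single 0 (-1) * f := by
      ext p
      rw [coeff_single_zero_mul, coeff_neg, neg_one_mul]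
    exact this ▸ hmul (hsingle _ _) hf
  { carrier := {f | IsLaurent Lhat f.coeff}
    mul_mem' := hmul
    one_mem' := hsingle 0 1
    add_mem' := fun {f g} hf hg => by
      rw [Set.mem_ofPred_eq, coeff_add']
      exact IsLaurent.add hL hn hf hg
    zero_mem' := by
      rw [Set.mem_ofPred_eq, ← single_eq_zero (a := (0 : G))]
      exact hsingle 0 0
    neg_mem' := hneg
    inv_mem' := fun f hf => by
      rcases eq_or_ne f 0 with rfl | hf0
      · rwa [inv_zero]
      -- Multiplying `f` by the inverse of its leading term gives `1 - h` with `h` of positive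
      -- order, so `f⁻¹` is that inverse monomial times the geometric series of `h`.
      have haux := unit_aux f (inv_mul_cancel₀ (leadingCoeff_ne_zero.mpr hf0)) _
        (neg_add_cancel f.order)
      rw [Set.mem_ofPred_eq, inv_def]
      refine hmul (hsingle _ _) (isLaurent_hsum_powers hL hn ?_ haux)
      rw [sub_eq_add_neg, coeff_add']
      exact (hsingle 0 1).add hL hn (hneg (hmul (hsingle _ _) hf)) }

theorem mem_laurentField_iff (hL : IsIsolatedTower Lhat) (hn : Module.finrank ℤ G = n)
    {f : G → ℂ} : f ∈ laurentField Lhat ↔ IsLaurent Lhat f := by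
  rw [laurentField, Set.mem_union, mem_laurentStar_iff, Set.mem_singleton_iff]
  refine ⟨?_, fun hf => ?_⟩
  · rintro (h | rfl)
    · exact h.2
    · exact isLaurent_of_support_subset_singleton hL hn (p₀ := 0) (by simp)
  · by_cases h0 : f = 0
    · exact Or.inr h0
    · exact Or.inl ⟨h0, hf⟩

/-- A series is determined by its coefficients. -/
noncomputable def laurentEquiv (hL : IsIsolatedTower Lhat) (hn : Module.finrank ℤ G = n) :
    laurentField Lhat ≃ laurentSubfield hL hn where
  toFun f := ⟨⟨f.1, ((mem_laurentField_iff hL hn).1 f.2).isPWO_support hL⟩,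
    (mem_laurentField_iff hL hn).1 f.2⟩
  invFun f := ⟨f.1.coeff, (mem_laurentField_iff hL hn).2 f.2⟩
  left_inv _ := rfl
  right_inv _ := rfl

/-- The order, as a homomorphism on the nonzero elements of a field of Hahn series. -/
noncomputable def orderHom (K : Subfield (HahnSeries G ℂ)) : Kˣ →* Multiplicative G where
  toFun f := Multiplicative.ofAdd f.val.val.order
  map_one' := by simp
  map_mul' f g := by
    rw [← ofAdd_add, Units.val_mul, Subfield.coe_mul, order_mul (by simp) (by simp)]

end Field

end OrderedLattice

theorem theorem1p3p1 {G : Type*} [AddCommGroup G] [LinearOrder G] [IsOrderedAddMonoid G]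
    (n : ℕ) (hG : Nonempty (G ≃+ (Fin n → ℤ)))
    (Lhat : Fin (n + 1) → AddSubgroup G) (hL : OrderedLattice.IsIsolatedTower Lhat) :
    ∃ _field : Field (OrderedLattice.laurentField Lhat),
      (∀ (f g : OrderedLattice.laurentField Lhat) (p : G),
        (f + g).val p = f.val p + g.val p) ∧
      (∀ (f g : OrderedLattice.laurentField Lhat) (p : G),
        (Function.support fun q : G => f.val q * g.val (p - q)).Finite ∧
        (f * g).val p = ∑ᶠ q : G, f.val q * g.val (p - q)) ∧
      ∃ ν : (OrderedLattice.laurentField Lhat)ˣ →* Multiplicative G,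
        ∀ f : (OrderedLattice.laurentField Lhat)ˣ,
          IsLeast {p : G | f.val.val p ≠ 0} (ν f).toAdd ∧
          ∃ C ∈ OrderedLattice.simpleCones Lhat,
            OrderedLattice.SupportedIn f.val.val C (ν f).toAdd := by
  obtain ⟨e⟩ := hG
  let b : Module.Basis (Fin n) ℤ G := Module.Basis.ofEquivFun e.toIntLinearEquiv
  have : Module.Finite ℤ G := Module.Finite.of_basis b
  have hn : Module.finrank ℤ G = n := by simpa using Module.finrank_eq_card_basis b
  let E := OrderedLattice.laurentEquiv hL hn
  -- The structure is transported along a bijection that keeps the coefficients, so addition is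
  -- coefficientwise by definition.
  let _ : Field (OrderedLattice.laurentField Lhat) := E.field
  refine ⟨inferInstance, fun f g p => rfl,
    fun f g p => OrderedLattice.coeff_mul_eq_finsum (E f).val (E g).val p,
    (OrderedLattice.orderHom _).comp (Units.map E.ringEquiv.toMonoidHom), fun f => ?_⟩
  have hne : (E f.val).val ≠ 0 := fun h => f.ne_zero (E.injective (Subtype.ext h))
  have hle : ∀ p, f.val.val p ≠ 0 → (E f.val).val.order ≤ p := fun p hp =>
    HahnSeries.order_le_of_coeff_ne_zero (x := (E f.val).val) hp
  exact ⟨⟨HahnSeries.coeff_order_eq_zero.not.2 hne, hle⟩,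
    ((OrderedLattice.mem_laurentField_iff hL hn).1 f.val.2).exists_supportedIn_of_le hL hn hle⟩
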